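/- All graphs are finite, simple and undirected. For a graph $G$, let $\rho(G)$ denote the largest eigenvalue of its adjacency matrix. For $2k+1\le n$, let $S_n^k$ be the graph obtained from the star $K_{1,n-1}$ by adding $k$ pairwise disjoint edges between its leaves, and let $C_5\bullet K_{1,s}$ be the graph obtained from the disjoint union of $C_5$ and the star $K_{1,s}$ by identifying one vertex of $C_5$ with the centre of the star. Theorem. Let $m\ge 51$. Then $\rho(S_{m-1}^2)>\sqrt{m-2}$. Moreover, if $G$ is a non-bipartite graph with $m$ edges and $\rho(G)\ge\rho(S_{m-1}^2)$, then $G$ contains a quadrilateral $C_4$ as a (not necessarily induced) subgraph unless $G$ is, up to isolated vertices, isomorphic to one of $S_m^1$, $S_{m-1}^2$ and $C_5\bullet K_{1,m-5}$. -/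

import Mathlib

namespace QuadrilateralSpectral

/-- The spectral radius `ρ(G)` of a finite graph: the largest eigenvalue of its adjacency matrix. -/
noncomputable def spectralRadius {V : Type*} [Fintype V] (G : SimpleGraph V) : ℝ :=
  open scoped Classical in sSup (spectrum ℝ (G.adjMatrix ℝ))

/-- On a nonempty vertex set the supremum above is attained, so it is the largest eigenvalue. -/
theorem spectralRadius_isGreatest {V : Type*} [Fintype V] [DecidableEq V] [Nonempty V]
    (G : SimpleGraph V) [DecidableRel G.Adj] :
    IsGreatest (spectrum ℝ (G.adjMatrix ℝ)) (spectralRadius G) := by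
  classical
  have h : (G.adjMatrix ℝ).IsHermitian := by
    rw [Matrix.IsHermitian, Matrix.conjTranspose_eq_transpose_of_trivial]
    exact G.isSymm_adjMatrix
  have hs : spectrum ℝ (G.adjMatrix ℝ) = Set.range h.eigenvalues :=
    h.spectrum_real_eq_range_eigenvalues
  have hr : spectralRadius G = sSup (spectrum ℝ (G.adjMatrix ℝ)) := by
    unfold spectralRadius
    congr!
  rw [hr, hs]
  exact ⟨(Set.range_nonempty _).csSup_mem (Set.finite_range _),
    fun x hx => le_csSup (Set.finite_range _).bddAbove hx⟩

/-- `S_n^k` (for `2 * k + 1 ≤ n`): the star `K_{1,n-1}` with centre `0` and leaves `1, …, n - 1`,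
together with the `k` disjoint edges `{1, 2}, {3, 4}, …, {2k - 1, 2k}` between leaves. -/
def starPlus (n k : ℕ) : SimpleGraph (Fin n) :=
  SimpleGraph.fromRel fun i j =>
    i.val = 0 ∨ ∃ t < k, i.val = 2 * t + 1 ∧ j.val = 2 * t + 2

/-- `C_5 • K_{1,s}`: the 5-cycle and the star `K_{1,s}`, with the centre of the star identified
with the vertex `0` of the cycle; the right summand holds the `s` leaves of the star. -/
def cycleStar (s : ℕ) : SimpleGraph (Fin 5 ⊕ Fin s) :=
  SimpleGraph.fromRel fun x y =>
    match x, y with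
    | .inl i, .inl j => (SimpleGraph.cycleGraph 5).Adj i j
    | .inl i, .inr _ => i = 0
    | .inr _, _ => False

/-- `G` is isomorphic to `H` after deleting the isolated vertices of `G`. -/
def IsoUpToIsolated {V W : Type*} (G : SimpleGraph V) (H : SimpleGraph W) : Prop :=
  Nonempty (G.induce G.support ≃g H)

end QuadrilateralSpectral

namespace QuadrilateralSpectral

open Finset SimpleGraph

/-! The argument is local, around a vertex `u` where the modulus `z` of an eigenvector for `ρ =
ρ(G)` attains its maximum `1`. Without a `C_4`, every other vertex shares at most one neighbour with
`u`, so sums over paths of length two from `u` become sums over end vertices. Let `d` be the degree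
of `u`, let `τ` and `ν` count the neighbours of `u` in triangles with `u` and the vertices at
distance two, let `ε` count the ordered far pairs, and let `X`, `Y` be the sums of `z` over the
first two sets. Then `2m = 2d + τ + 2ν + ε`, `ρ² ≤ d + X + Y`, `ρX ≤ τ + X + Y` and `ρY ≤ ν + ε`.

The quotient of `S_{m-1}^2` gives a root `r > √(m-2)` of `(r² - (m-2))(r-1) = 4` with `r ≤
ρ(S_{m-1}^2)`; only this inequality is needed. As `m ≥ 51` gives `r > 7`, the four relations force
the even number `τ + 2ν + ε` to be at most `4` (`excess_le_four`). Few cases remain: `τ = 0` makes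
`G` bipartite or `ρ` too small, `τ = 4` gives `S_{m-1}^2`, `τ = 2` with `ν = ε = 0` gives `S_m^1`,
and the rest contradict the root equation. The alternative `C_5 • K_{1,m-5}` is never needed. -/

open scoped Classical in
/-- An explicit eigenvector bounds the spectral radius from below. -/
theorem le_spectralRadius_of_sum_eq {V : Type*} [Fintype V] (G : SimpleGraph V) {r : ℝ}
    (x : V → ℝ) (hx : x ≠ 0) (h : ∀ v, (∑ w, if G.Adj v w then x w else 0) = r * x v) :
    r ≤ spectralRadius G := by
  obtain ⟨v, hv⟩ := Function.ne_iff.1 hx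
  have : Nonempty V := ⟨v⟩
  refine (spectralRadius_isGreatest G).2 ?_
  rw [← Matrix.spectrum_toLin']
  refine Module.End.HasEigenvalue.mem_spectrum
    (Module.End.hasEigenvalue_of_hasEigenvector (x := x) ⟨?_, hx⟩)
  rw [Module.End.mem_eigenspace_iff]
  ext v
  rw [Matrix.toLin'_apply, adjMatrix_mulVec_apply, neighborFinset_eq_filter, sum_filter]
  simpa using h v

open scoped Classical in
/-- The normalised modulus of an eigenvector for `ρ(G)`: entries in `[0, 1]`, maximum attained,
and `ρ z ≤ A z` entrywise. -/
theorem exists_normalized_subeigenvector {V : Type*} [Fintype V] [Nonempty V] (G : SimpleGraph V)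
    (hρ : 0 ≤ spectralRadius G) :
    ∃ (u : V) (z : V → ℝ), z u = 1 ∧ (∀ v, 0 ≤ z v) ∧ (∀ v, z v ≤ 1) ∧
      ∀ v, spectralRadius G * z v ≤ ∑ w, if G.Adj v w then z w else 0 := by
  have h := (spectralRadius_isGreatest G).1
  rw [← Matrix.spectrum_toLin'] at h
  obtain ⟨y, hy, hy0⟩ := (Module.End.HasEigenvalue.of_mem_spectrum h).exists_hasEigenvector
  rw [Module.End.mem_eigenspace_iff, Matrix.toLin'_apply] at hy
  obtain ⟨u, -, hu⟩ := exists_max_image univ (fun v => |y v|) univ_nonempty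
  have hpos : 0 < |y u| := by
    obtain ⟨v, hv⟩ := Function.ne_iff.1 hy0
    exact (abs_pos.2 hv).trans_le (hu v (mem_univ v))
  refine ⟨u, fun v => |y v| / |y u|, div_self hpos.ne', fun v => by positivity,
    fun v => (div_le_one hpos).2 (hu v (mem_univ v)), fun v => ?_⟩
  have hv : ∑ w ∈ G.neighborFinset v, y w = spectralRadius G * y v := by
    simpa [adjMatrix_mulVec_apply] using congrFun hy v
  have : spectralRadius G * |y v| ≤ ∑ w ∈ G.neighborFinset v, |y w| := by
    rw [← abs_of_nonneg hρ, ← abs_mul, ← hv]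
    exact abs_sum_le_sum_abs _ _
  rw [← sum_filter, ← neighborFinset_eq_filter, ← sum_div, ← mul_div_assoc]
  gcongr

/-! ### The spectral radius of `S_{m-1}^2` -/

/-- The largest root of the characteristic equation of `S_{m-1}^2`. -/
theorem exists_root {m : ℝ} (hm : 51 ≤ m) :
    ∃ r : ℝ, √(m - 2) < r ∧ 7 < r ∧ (r ^ 2 - (m - 2)) * (r - 1) = 4 := by
  -- The threshold `51 = 7² + 2` enters here.
  have h7 : 7 ≤ √(m - 2) := Real.le_sqrt_of_sq_le (by linarith)
  have hs : √(m - 2) ^ 2 = m - 2 := Real.sq_sqrt (by linarith)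
  have hle : √(m - 2) ≤ m := by nlinarith
  have hc : ContinuousOn (fun r : ℝ => (r ^ 2 - (m - 2)) * (r - 1)) (Set.Icc √(m - 2) m) := by
    fun_prop
  obtain ⟨r, hr, hr4⟩ := intermediate_value_Icc hle hc
    (show (4 : ℝ) ∈ Set.Icc _ _ from ⟨by simp [hs], by nlinarith⟩)
  have hlt : √(m - 2) < r := by
    refine lt_of_le_of_ne hr.1 fun h => ?_
    simp [← h, hs] at hr4
  exact ⟨r, hlt, h7.trans_lt hlt, hr4⟩

theorem starPlus_two_adj {n : ℕ} (i j : Fin n) :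
    (starPlus n 2).Adj i j ↔ i.val ≠ j.val ∧
      ((i.val = 0 ∨ i.val = 1 ∧ j.val = 2 ∨ i.val = 3 ∧ j.val = 4) ∨
       (j.val = 0 ∨ j.val = 1 ∧ i.val = 2 ∨ j.val = 3 ∧ i.val = 4)) := by
  have key : ∀ a b : ℕ, (∃ t < 2, a = 2 * t + 1 ∧ b = 2 * t + 2) ↔
      (a = 1 ∧ b = 2 ∨ a = 3 ∧ b = 4) := by
    intro a b
    constructor
    · rintro ⟨t, ht, h⟩
      omega
    · rintro (h | h)
      · exact ⟨0, by omega, by omega, by omega⟩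
      · exact ⟨1, by omega, by omega, by omega⟩
  simp only [starPlus, fromRel_adj, key, ne_eq, Fin.ext_iff]

theorem root_le_spectralRadius_starPlus {m : ℕ} (hm : 51 ≤ m) {r : ℝ} (hr : 1 < r)
    (h : (r ^ 2 - ((m : ℝ) - 2)) * (r - 1) = 4) :
    r ≤ spectralRadius (starPlus (m - 1) 2) := by
  classical
  -- The `m - 1 = p + 5` vertices are the centre, four leaves in triangles and `p` pendant leaves.
  obtain ⟨p, rfl⟩ : ∃ p, m = p + 6 := ⟨m - 6, by omega⟩
  have hr0 : r ≠ 0 := by linarith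
  have hr1 : r - 1 ≠ 0 := by linarith
  -- With centre entry `1`, the equations at the leaves force these values; the equation at the
  -- centre is then the root equation.
  set g : ℕ → ℝ := fun i => if i = 0 then 1 else if i ≤ 4 then 1 / (r - 1) else 1 / r with hg
  refine le_spectralRadius_of_sum_eq _ (fun i => g i.val) ?_ ?_
  · refine Function.ne_iff.2 ⟨⟨0, by omega⟩, ?_⟩
    simp [hg]
  · rintro ⟨v, hv⟩
    simp only [starPlus_two_adj]
    rw [Fin.sum_univ_eq_sum_range (fun j => if (v ≠ j ∧
      ((v = 0 ∨ v = 1 ∧ j = 2 ∨ v = 3 ∧ j = 4) ∨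
       (j = 0 ∨ j = 1 ∧ v = 2 ∨ j = 3 ∧ v = 4))) then g j else 0) (p + 6 - 1),
      show p + 6 - 1 = p + 5 by omega]
    simp only [sum_range_succ']
    push_cast at h
    by_cases h5 : 5 ≤ v
    · have hs : ∑ k ∈ range p, (if (v ≠ k + 1 + 1 + 1 + 1 + 1 ∧
          ((v = 0 ∨ v = 1 ∧ k + 1 + 1 + 1 + 1 + 1 = 2 ∨ v = 3 ∧ k + 1 + 1 + 1 + 1 + 1 = 4) ∨
          (k + 1 + 1 + 1 + 1 + 1 = 0 ∨ k + 1 + 1 + 1 + 1 + 1 = 1 ∧ v = 2 ∨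
            k + 1 + 1 + 1 + 1 + 1 = 3 ∧ v = 4))) then g (k + 1 + 1 + 1 + 1 + 1) else 0) = 0 :=
        sum_eq_zero fun k _ => if_neg (by omega)
      rw [hs]
      have h1 : v ≠ 0 := by omega
      have h2 : v ≠ 1 := by omega
      have h3 : v ≠ 2 := by omega
      have h4 : v ≠ 3 := by omega
      have h6 : v ≠ 4 := by omega
      have h7 : ¬ v ≤ 4 := by omega
      simp [hg, h1, h2, h3, h4, h6, h7, hr0]
    · have h' : v = 0 ∨ v = 1 ∨ v = 2 ∨ v = 3 ∨ v = 4 := by omega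
      rcases h' with rfl | rfl | rfl | rfl | rfl <;>
        simp [hg, show ∀ x, ¬ x + 1 + 1 + 1 + 1 < 4 by omega]
      all_goals field_simp
      all_goals linarith

/-! ### Recognising `C_4` and `S_n^k` -/

/-- A closed walk of length four on four distinct vertices gives a copy of `C_4`. -/
theorem cycleGraph_four_isContained {V : Type*} {G : SimpleGraph V} {a b c d : V}
    (hac : a ≠ c) (hbd : b ≠ d) (hab : G.Adj a b) (hbc : G.Adj b c) (hcd : G.Adj c d)
    (hda : G.Adj d a) : (cycleGraph 4).IsContained G := by
  refine ⟨⟨⟨![a, b, c, d], ?_⟩, ?_⟩⟩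
  · intro i j hij
    have := hab.symm
    have := hbc.symm
    have := hcd.symm
    have := hda.symm
    rw [cycleGraph_adj] at hij
    fin_cases i <;> fin_cases j <;> first | assumption | (exfalso; revert hij; decide)
  · have := hab.ne
    have := hbc.ne
    have := hcd.ne
    have := hda.ne
    intro i j hij
    fin_cases i <;> fin_cases j <;> simp_all

/-- Recognition of `S_n^k` among graphs with isolated vertices. -/
theorem isoUpToIsolated_starPlus {V : Type*} [Fintype V] (G : SimpleGraph V) {n k : ℕ}
    (hcard : G.support.ncard = n) (f : ℕ → V) (hf : ∀ i ≤ 2 * k, f i ∈ G.support)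
    (hinj : Set.InjOn f {i | i ≤ 2 * k})
    (hstar : ∀ x ∈ G.support, x ≠ f 0 → G.Adj (f 0) x)
    (hadj : ∀ x y, x ≠ f 0 → y ≠ f 0 → (G.Adj x y ↔ ∃ t < k,
      (x = f (2 * t + 1) ∧ y = f (2 * t + 2)) ∨ (y = f (2 * t + 1) ∧ x = f (2 * t + 2)))) :
    IsoUpToIsolated G (starPlus n k) := by
  classical
  have hc : Fintype.card (Fin n) = #G.support.toFinset := by
    rw [Fintype.card_fin, ← hcard, Set.ncard_eq_toFinset_card']
  have hmem : ∀ {x}, x ∈ G.support.toFinset ↔ x ∈ G.support := Set.mem_toFinset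
  -- The leaves outside the matching are interchangeable, so any bijection extending `f` is an
  -- isomorphism.
  obtain ⟨g, hg⟩ := Set.MapsTo.exists_equiv_extend_of_card_eq hc
    (s := {i : Fin n | i.val ≤ 2 * k}) (f := fun i => f i.val)
    (fun i hi => by simpa using hf i.val hi)
    (fun i hi j hj hij => Fin.ext (hinj hi hj hij))
  have hnk : 2 * k < n := by
    have h1 : (range (2 * k + 1)).image f ⊆ G.support.toFinset := by
      intro x hx
      obtain ⟨i, hi, rfl⟩ := mem_image.1 hx
      exact hmem.2 (hf i (by simpa [Nat.lt_succ_iff] using hi))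
    have h2 := card_le_card h1
    rw [card_image_of_injOn (fun i hi j hj hij => hinj (by simpa [Nat.lt_succ_iff] using hi)
      (by simpa [Nat.lt_succ_iff] using hj) hij), card_range, ← hc, Fintype.card_fin] at h2
    omega
  have hval : ∀ (i : Fin n) (s : ℕ), s ≤ 2 * k → ((g i : V) = f s ↔ i.val = s) := by
    intro i s hs
    have h1 : (g ⟨s, by omega⟩ : V) = f s := hg ⟨s, by omega⟩ hs
    rw [← h1, ← Subtype.ext_iff, g.injective.eq_iff, Fin.ext_iff]
  have key : ∀ i j : Fin n, G.Adj (g i) (g j) ↔ (starPlus n k).Adj i j := by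
    intro i j
    simp only [starPlus, fromRel_adj]
    have hsi : (g i : V) ∈ G.support := hmem.1 (g i).2
    have hsj : (g j : V) ∈ G.support := hmem.1 (g j).2
    by_cases hij : i = j
    · subst hij
      simp
    have hij' : (i : ℕ) ≠ j := fun h => hij (Fin.ext h)
    by_cases hi : i.val = 0
    · have h0 := (hval i 0 (by omega)).2 hi
      have : (g j : V) ≠ f 0 := by
        rw [ne_eq, hval j 0 (by omega)]
        omega
      simp [hij, hi, h0, hstar _ hsj this]
    by_cases hj : j.val = 0
    · have h0 := (hval j 0 (by omega)).2 hj
      have : (g i : V) ≠ f 0 := by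
        rw [ne_eq, hval i 0 (by omega)]
        omega
      simp [hij, hj, h0, (hstar _ hsi this).symm]
    rw [hadj _ _ (by rwa [ne_eq, hval i 0 (by omega)]) (by rwa [ne_eq, hval j 0 (by omega)])]
    have hrw : ∀ (i j : Fin n) (t : ℕ), t < k →
        (((g i : V) = f (2 * t + 1) ∧ (g j : V) = f (2 * t + 2)) ↔
          (i.val = 2 * t + 1 ∧ j.val = 2 * t + 2)) := by
      intro i j t ht
      rw [hval i _ (by omega), hval j _ (by omega)]
    simp only [hij, hi, hj, ne_eq, not_false_eq_true, true_and, false_or]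
    constructor
    · rintro ⟨t, ht, h | h⟩
      · exact Or.inl ⟨t, ht, (hrw i j t ht).1 h⟩
      · exact Or.inr ⟨t, ht, (hrw j i t ht).1 h⟩
    · rintro (⟨t, ht, h⟩ | ⟨t, ht, h⟩)
      · exact ⟨t, ht, Or.inl ((hrw i j t ht).2 h)⟩
      · exact ⟨t, ht, Or.inr ((hrw j i t ht).2 h)⟩
  refine ⟨RelIso.symm ⟨g.trans (Equiv.subtypeEquivRight fun x => hmem), ?_⟩⟩
  intro i j
  exact key i j

/-! ### Edge and walk counts around a vertex -/

section LocalStructure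

open scoped Classical

variable {V : Type*} [Fintype V] (G : SimpleGraph V) (u : V)

/-- The vertices other than `u` that are not adjacent to `u`. -/
noncomputable def farVertices : Finset V := univ.filter fun w => w ≠ u ∧ ¬ G.Adj u w

/-- The neighbours of `u` that lie in a triangle through `u`. -/
noncomputable def triangleNbrs : Finset V :=
  (G.neighborFinset u).filter fun w => ∃ v, G.Adj u v ∧ G.Adj v w

/-- The vertices at distance two from `u`. -/
noncomputable def secondNbrs : Finset V :=
  (farVertices G u).filter fun w => ∃ v, G.Adj u v ∧ G.Adj v w

/-- The ordered pairs of adjacent vertices that are far from `u`. -/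
noncomputable def farPairs : Finset (V × V) :=
  (farVertices G u ×ˢ farVertices G u).filter fun p => G.Adj p.1 p.2

variable {G u}

theorem mem_farVertices {w : V} : w ∈ farVertices G u ↔ w ≠ u ∧ ¬ G.Adj u w := by
  simp [farVertices]

theorem mem_triangleNbrs {w : V} :
    w ∈ triangleNbrs G u ↔ G.Adj u w ∧ ∃ v, G.Adj u v ∧ G.Adj v w := by
  simp [triangleNbrs]

theorem mem_secondNbrs {w : V} :
    w ∈ secondNbrs G u ↔ (w ≠ u ∧ ¬ G.Adj u w) ∧ ∃ v, G.Adj u v ∧ G.Adj v w := by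
  simp [secondNbrs, mem_farVertices]

theorem mem_farPairs {p : V × V} :
    p ∈ farPairs G u ↔ ((p.1 ≠ u ∧ ¬ G.Adj u p.1) ∧ (p.2 ≠ u ∧ ¬ G.Adj u p.2)) ∧
      G.Adj p.1 p.2 := by
  simp [farPairs, mem_farVertices]

theorem sum_eq_center_add_nbrs_add_far (F : V → ℝ) :
    ∑ w, F w = F u + ∑ w ∈ G.neighborFinset u, F w + ∑ w ∈ farVertices G u, F w := by
  have h1 : (univ : Finset V) = insert u (G.neighborFinset u ∪ farVertices G u) := by
    ext w
    simp only [mem_univ, mem_insert, mem_union, mem_neighborFinset, mem_farVertices, true_iff]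
    tauto
  rw [h1, sum_insert (by simp [mem_farVertices]), sum_union, add_assoc]
  rw [Finset.disjoint_left]
  intro w hw hw'
  exact (mem_farVertices.1 hw').2 (by simpa using hw)

/-- If `u` has at most one common neighbour with every other vertex, sums over paths of length two
from `u` reduce to sums over their end vertices. -/
theorem sum_paths_two (hC : ∀ w ≠ u, ∀ v v', G.Adj u v → G.Adj v w → G.Adj u v' → G.Adj v' w →
    v = v') (S : Finset V) (hS : u ∉ S) (g : V → ℝ) :
    ∑ v ∈ G.neighborFinset u, ∑ w ∈ S, (if G.Adj v w then g w else 0) =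
      ∑ w ∈ S.filter fun w => ∃ v, G.Adj u v ∧ G.Adj v w, g w := by
  rw [sum_comm, sum_filter]
  refine sum_congr rfl fun w hw => ?_
  split_ifs with h
  · obtain ⟨v, huv, hvw⟩ := h
    rw [sum_eq_single v, if_pos hvw]
    · intro v' hv' hne
      refine if_neg fun hv'w => hne ?_
      exact hC w (fun h => hS (h ▸ hw)) v' v (by simpa using hv') hv'w huv hvw
    · simp [huv]
  · refine sum_eq_zero fun v hv => if_neg fun hvw => h ⟨v, by simpa using hv, hvw⟩

theorem card_farPairs : ((farPairs G u).card : ℝ) =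
    ∑ v ∈ farVertices G u, ∑ w ∈ farVertices G u, (if G.Adj v w then (1 : ℝ) else 0) := by
  rw [farPairs, card_filter, ← sum_product']
  push_cast
  rfl

theorem sum_nbrs_nbrs
    (hC : ∀ w ≠ u, ∀ v v', G.Adj u v → G.Adj v w → G.Adj u v' → G.Adj v' w → v = v') (g : V → ℝ) :
    ∑ v ∈ G.neighborFinset u, ∑ w ∈ G.neighborFinset u, (if G.Adj v w then g w else 0) =
      ∑ w ∈ triangleNbrs G u, g w :=
  sum_paths_two hC _ (by simp) g

theorem sum_nbrs_far
    (hC : ∀ w ≠ u, ∀ v v', G.Adj u v → G.Adj v w → G.Adj u v' → G.Adj v' w → v = v') (g : V → ℝ) :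
    ∑ v ∈ G.neighborFinset u, ∑ w ∈ farVertices G u, (if G.Adj v w then g w else 0) =
      ∑ w ∈ secondNbrs G u, g w :=
  sum_paths_two hC _ (by simp [mem_farVertices]) g

theorem sum_far_nbrs
    (hC : ∀ w ≠ u, ∀ v v', G.Adj u v → G.Adj v w → G.Adj u v' → G.Adj v' w → v = v') :
    ∑ w ∈ farVertices G u, ∑ v ∈ G.neighborFinset u, (if G.Adj w v then (1 : ℝ) else 0) =
      (secondNbrs G u).card := by
  have := sum_nbrs_far hC (fun _ => 1)
  rw [sum_comm] at this
  simpa [G.adj_comm] using this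

theorem sum_adj_nbrs
    (hC : ∀ w ≠ u, ∀ v v', G.Adj u v → G.Adj v w → G.Adj u v' → G.Adj v' w → v = v') (g : V → ℝ) :
    ∑ v ∈ G.neighborFinset u, ∑ w, (if G.Adj v w then g w else 0) =
      G.degree u * g u + ∑ w ∈ triangleNbrs G u, g w + ∑ w ∈ secondNbrs G u, g w := by
  simp only [sum_eq_center_add_nbrs_add_far (G := G) (u := u), sum_add_distrib]
  rw [sum_nbrs_nbrs hC, sum_nbrs_far hC]
  congr 2
  rw [sum_congr rfl (g := fun _ => g u), sum_const, card_neighborFinset_eq_degree, nsmul_eq_mul]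
  intro v hv
  exact if_pos (by simpa [G.adj_comm] using hv)

/-- The degree sum is split over `u`, its neighbours and the far vertices. A triangle neighbour has
exactly one neighbour inside `N(u)`, and so has a vertex at distance two. -/
theorem two_mul_card_edges
    (hC : ∀ w ≠ u, ∀ v v', G.Adj u v → G.Adj v w → G.Adj u v' → G.Adj v' w → v = v') :
    2 * G.edgeSet.ncard =
      2 * G.degree u + #(triangleNbrs G u) + 2 * #(secondNbrs G u) + #(farPairs G u) := by
  have h1 : (∑ v, ∑ w, (if G.Adj v w then (1 : ℝ) else 0)) = 2 * (G.edgeSet.ncard : ℝ) := by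
    have h := G.sum_degrees_eq_twice_card_edges
    rw [← coe_edgeFinset, Set.ncard_coe_finset]
    have h' : (∑ v, (G.degree v : ℝ)) = 2 * (#G.edgeFinset : ℝ) := by exact_mod_cast h
    rw [← h']
    refine sum_congr rfl fun v _ => ?_
    rw [← sum_filter, ← neighborFinset_eq_filter]
    simp
  rw [sum_eq_center_add_nbrs_add_far (G := G) (u := u), sum_adj_nbrs hC] at h1
  have h2 : ∑ w, (if G.Adj u w then (1 : ℝ) else 0) = G.degree u := by
    rw [← sum_filter, ← neighborFinset_eq_filter]
    simp
  have h3 : ∑ v ∈ farVertices G u, ∑ w, (if G.Adj v w then (1 : ℝ) else 0) =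
      #(secondNbrs G u) + #(farPairs G u) := by
    simp only [sum_eq_center_add_nbrs_add_far (G := G) (u := u), sum_add_distrib]
    rw [sum_far_nbrs hC, ← card_farPairs, sum_eq_zero, zero_add]
    exact fun v hv => if_neg fun h => (mem_farVertices.1 hv).2 h.symm
  rw [h2, h3] at h1
  simp only [sum_const, nsmul_eq_mul, mul_one] at h1
  have : ((2 * G.edgeSet.ncard : ℕ) : ℝ) = ((2 * G.degree u + #(triangleNbrs G u) +
      2 * #(secondNbrs G u) + #(farPairs G u) : ℕ) : ℝ) := by
    push_cast
    linarith
  exact_mod_cast this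

/-- The inequality `ρ z ≤ A z` is applied twice, at `u` and at each neighbour of `u`. -/
theorem sq_le_degree_add
    (hC : ∀ w ≠ u, ∀ v v', G.Adj u v → G.Adj v w → G.Adj u v' → G.Adj v' w → v = v')
    {ρ : ℝ} {z : V → ℝ} (hρ : 0 ≤ ρ) (hu : z u = 1)
    (hz : ∀ v, ρ * z v ≤ ∑ w, if G.Adj v w then z w else 0) :
    ρ ^ 2 ≤ G.degree u + ∑ w ∈ triangleNbrs G u, z w + ∑ w ∈ secondNbrs G u, z w := by
  have h1 := hz u
  rw [hu, mul_one, ← sum_filter, ← neighborFinset_eq_filter] at h1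
  calc ρ ^ 2 = ρ * ρ := sq ρ
    _ ≤ ρ * ∑ w ∈ G.neighborFinset u, z w := by gcongr
    _ = ∑ w ∈ G.neighborFinset u, ρ * z w := mul_sum _ _ _
    _ ≤ ∑ v ∈ G.neighborFinset u, ∑ w, (if G.Adj v w then z w else 0) :=
      sum_le_sum fun v _ => hz v
    _ = _ := by rw [sum_adj_nbrs hC, hu, mul_one]

theorem mul_sum_triangleNbrs_le
    (hC : ∀ w ≠ u, ∀ v v', G.Adj u v → G.Adj v w → G.Adj u v' → G.Adj v' w → v = v')
    {ρ : ℝ} {z : V → ℝ} (hu : z u = 1) (hz0 : ∀ v, 0 ≤ z v)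
    (hz : ∀ v, ρ * z v ≤ ∑ w, if G.Adj v w then z w else 0) :
    ρ * ∑ w ∈ triangleNbrs G u, z w ≤
      #(triangleNbrs G u) + ∑ w ∈ triangleNbrs G u, z w + ∑ w ∈ secondNbrs G u, z w := by
  have hsub : triangleNbrs G u ⊆ G.neighborFinset u := filter_subset _ _
  have hnn : ∀ v w, 0 ≤ (if G.Adj v w then z w else 0) := fun v w => by
    split_ifs
    exacts [hz0 w, le_rfl]
  calc ρ * ∑ w ∈ triangleNbrs G u, z w = ∑ w ∈ triangleNbrs G u, ρ * z w := mul_sum _ _ _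
    _ ≤ ∑ v ∈ triangleNbrs G u, ∑ w, (if G.Adj v w then z w else 0) :=
      sum_le_sum fun v _ => hz v
    _ = ∑ v ∈ triangleNbrs G u, (if G.Adj v u then z u else 0) +
        ∑ v ∈ triangleNbrs G u, ∑ w ∈ G.neighborFinset u, (if G.Adj v w then z w else 0) +
        ∑ v ∈ triangleNbrs G u, ∑ w ∈ farVertices G u, (if G.Adj v w then z w else 0) := by
      simp only [sum_eq_center_add_nbrs_add_far (G := G) (u := u), sum_add_distrib]
    -- The outer sums grow from the triangle neighbours to all of `N(u)`, where paths of length two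
    -- can be collapsed to their ends.
    _ ≤ ∑ v ∈ triangleNbrs G u, 1 +
        ∑ v ∈ G.neighborFinset u, ∑ w ∈ G.neighborFinset u, (if G.Adj v w then z w else 0) +
        ∑ v ∈ G.neighborFinset u, ∑ w ∈ farVertices G u, (if G.Adj v w then z w else 0) := by
      refine add_le_add (add_le_add ?_ ?_) ?_
      · refine sum_le_sum fun v _ => ?_
        split_ifs
        exacts [hu.le, zero_le_one]
      · exact sum_le_sum_of_subset_of_nonneg hsub fun v _ _ => sum_nonneg fun w _ => hnn v w
      · exact sum_le_sum_of_subset_of_nonneg hsub fun v _ _ => sum_nonneg fun w _ => hnn v w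
    _ = _ := by
      rw [sum_nbrs_nbrs hC, sum_nbrs_far hC]
      simp

/-- Bounding `z` by `1` turns the sum into a count of ordered adjacencies starting at far vertices.
-/
theorem mul_sum_secondNbrs_le
    (hC : ∀ w ≠ u, ∀ v v', G.Adj u v → G.Adj v w → G.Adj u v' → G.Adj v' w → v = v')
    {ρ : ℝ} {z : V → ℝ} (hz1 : ∀ v, z v ≤ 1)
    (hz : ∀ v, ρ * z v ≤ ∑ w, if G.Adj v w then z w else 0) :
    ρ * ∑ w ∈ secondNbrs G u, z w ≤ #(secondNbrs G u) + #(farPairs G u) := by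
  have hsub : secondNbrs G u ⊆ farVertices G u := filter_subset _ _
  have hle : ∀ v w, (if G.Adj v w then z w else 0) ≤ (if G.Adj v w then (1 : ℝ) else 0) :=
    fun v w => by
      split_ifs
      exacts [hz1 w, le_rfl]
  have hnn : ∀ v w, 0 ≤ (if G.Adj v w then (1 : ℝ) else 0) := fun v w => by
    split_ifs <;> norm_num
  calc ρ * ∑ w ∈ secondNbrs G u, z w = ∑ w ∈ secondNbrs G u, ρ * z w := mul_sum _ _ _
    _ ≤ ∑ v ∈ secondNbrs G u, ∑ w, (if G.Adj v w then z w else 0) :=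
      sum_le_sum fun v _ => hz v
    _ ≤ ∑ v ∈ secondNbrs G u, ∑ w, (if G.Adj v w then (1 : ℝ) else 0) :=
      sum_le_sum fun v _ => sum_le_sum fun w _ => hle v w
    _ ≤ ∑ v ∈ farVertices G u, ∑ w, (if G.Adj v w then (1 : ℝ) else 0) :=
      sum_le_sum_of_subset_of_nonneg hsub fun v _ _ => sum_nonneg fun w _ => hnn v w
    _ = ∑ v ∈ farVertices G u, (if G.Adj v u then (1 : ℝ) else 0) +
        ∑ v ∈ farVertices G u, ∑ w ∈ G.neighborFinset u, (if G.Adj v w then (1 : ℝ) else 0) +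
        ∑ v ∈ farVertices G u, ∑ w ∈ farVertices G u, (if G.Adj v w then (1 : ℝ) else 0) := by
      simp only [sum_eq_center_add_nbrs_add_far (G := G) (u := u), sum_add_distrib]
    _ = _ := by
      rw [sum_far_nbrs hC, ← card_farPairs, sum_eq_zero, zero_add]
      exact fun v hv => if_neg fun h => (mem_farVertices.1 hv).2 h.symm

end LocalStructure

/-! ### Numerical consequences -/

section Numeric

variable {m d τ ν ε : ℕ} {r ρ X Y : ℝ}

theorem excess_le_four (hr : 7 < r) (hroot : (r ^ 2 - ((m : ℝ) - 2)) * (r - 1) = 4) (hρ : r ≤ ρ)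
    (hcount : 2 * m = 2 * d + τ + 2 * ν + ε) (h1 : ρ ^ 2 ≤ d + X + Y)
    (h2 : ρ * X ≤ τ + X + Y) (h3 : ρ * Y ≤ ν + ε) (hX : 0 ≤ X) (hY : 0 ≤ Y) :
    τ + 2 * ν + ε ≤ 4 := by
  by_contra! hlt
  -- The excess equals `2m - 2d`, hence is even, so exceeding `4` means at least `6`.
  have h6 : 6 ≤ τ + 2 * ν + ε := by omega
  have h6' : (6 : ℝ) ≤ τ + 2 * ν + ε := by exact_mod_cast h6
  have hc : (2 : ℝ) * m = 2 * d + τ + 2 * ν + ε := by exact_mod_cast hcount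
  have hsq : (m : ℝ) - 2 < r ^ 2 := by
    by_contra! h
    nlinarith
  have hρ2 : r ^ 2 ≤ ρ ^ 2 := by gcongr
  have hX' : 6 * X ≤ τ + Y := by nlinarith
  have hY' : 7 * Y ≤ ν + ε := by nlinarith
  have hν : (0 : ℝ) ≤ ν := ν.cast_nonneg
  -- Here `X + Y ≤ (τ + ν + ε)/6`, while `ρ² > m - 2` gives `X + Y > (τ + 2ν + ε)/2 - 2`; together
  -- they force the excess below `6`.
  linarith

/-- Both factors of `(x² - (m-2))(x-1)` are nonnegative at `r` and increase from there. -/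
theorem four_le_of_root_le (hr : 7 < r) (hroot : (r ^ 2 - ((m : ℝ) - 2)) * (r - 1) = 4)
    (hρ : r ≤ ρ) : 4 ≤ (ρ ^ 2 - ((m : ℝ) - 2)) * (ρ - 1) := by
  have hsq : 0 ≤ r ^ 2 - ((m : ℝ) - 2) := by
    by_contra! h
    nlinarith
  have hρ2 : r ^ 2 ≤ ρ ^ 2 := by gcongr
  rw [← hroot]
  exact mul_le_mul (by linarith) (by linarith) (by linarith) (by linarith)

end Numeric

/-! ### Case analysis of the local structure -/

section Cases

open scoped Classical

variable {V : Type*} [Fintype V] {G : SimpleGraph V} {u : V}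

theorem swap_mem_farPairs {p : V × V} (h : p ∈ farPairs G u) : p.swap ∈ farPairs G u := by
  rw [mem_farPairs] at h ⊢
  exact ⟨h.1.symm, h.2.symm⟩

/-- A graph with no triangle through `u`, at most one edge far from `u`, and at most one vertex at
distance two from `u` if that edge is present, is bipartite. -/
theorem isBipartite_of_triangleNbrs_eq_empty (hT : triangleNbrs G u = ∅)
    (hE : #(farPairs G u) ≤ 2) (hEN : 2 * #(secondNbrs G u) + #(farPairs G u) ≤ 4) :
    G.IsBipartite := by
  -- `q` marks one end of the far edge, if there is one, chosen not at distance two from `u`. That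
  -- end can then join the colour class of `N(u)`.
  obtain ⟨q, hq⟩ : ∃ q : V → Prop, (∀ x, q x → x ≠ u ∧ ¬ G.Adj u x ∧ x ∉ secondNbrs G u) ∧
      ∀ x y, (x, y) ∈ farPairs G u → (q x ↔ ¬ q y) := by
    rcases (farPairs G u).eq_empty_or_nonempty with h0 | ⟨⟨a, b⟩, hab⟩
    · exact ⟨fun _ => False, by simp, by simp [h0]⟩
    have hba : (b, a) ∈ farPairs G u := swap_mem_farPairs hab
    have hne : a ≠ b := (mem_farPairs.1 hab).2.ne
    have hpair : farPairs G u = {(a, b), (b, a)} := by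
      refine (eq_of_subset_of_card_le (by simp [insert_subset_iff, hab, hba]) ?_).symm
      rw [card_pair (by simp [hne])]
      exact hE
    have hcard : #(farPairs G u) = 2 := by
      rw [hpair, card_pair (by simp [hne])]
    have hN : #(secondNbrs G u) ≤ 1 := by omega
    rw [card_le_one] at hN
    obtain ⟨⟨ha, hb⟩, -⟩ := mem_farPairs.1 hab
    by_cases has : a ∈ secondNbrs G u
    · have hbs : b ∉ secondNbrs G u := fun h => hne (hN a has b h)
      refine ⟨fun x => x = b, ?_, ?_⟩
      · rintro x rfl
        exact ⟨hb.1, hb.2, hbs⟩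
      · intro x y hxy
        rw [hpair] at hxy
        simp only [mem_insert, mem_singleton, Prod.mk.injEq] at hxy
        rcases hxy with ⟨rfl, rfl⟩ | ⟨rfl, rfl⟩ <;> simp [hne]
    · refine ⟨fun x => x = a, ?_, ?_⟩
      · rintro x rfl
        exact ⟨ha.1, ha.2, has⟩
      · intro x y hxy
        rw [hpair] at hxy
        simp only [mem_insert, mem_singleton, Prod.mk.injEq] at hxy
        rcases hxy with ⟨rfl, rfl⟩ | ⟨rfl, rfl⟩ <;> simp [hne.symm]
  obtain ⟨hq1, hq2⟩ := hq
  have hTe : ∀ x y, G.Adj u x → G.Adj u y → ¬ G.Adj x y := by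
    intro x y hx hy hxy
    have : y ∈ triangleNbrs G u := mem_triangleNbrs.2 ⟨hy, x, hx, hxy⟩
    simp [hT] at this
  have hNq : ∀ x y, G.Adj u x → G.Adj x y → ¬ q y := by
    intro x y hx hxy hy
    exact (hq1 y hy).2.2 (mem_secondNbrs.2 ⟨⟨(hq1 y hy).1, (hq1 y hy).2.1⟩, x, hx, hxy⟩)
  have hqu : ¬ q u := fun h => (hq1 u h).1 rfl
  let C : G.Coloring Prop := Coloring.mk (fun x => G.Adj u x ∨ q x) (by
    intro x y hxy heq
    rw [eq_iff_iff] at heq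
    by_cases hxu : x = u
    · subst hxu
      simp [hxy, hqu] at heq
    by_cases hyu : y = u
    · subst hyu
      simp [hxy.symm, hqu] at heq
    by_cases hx : G.Adj u x
    · have hy : ¬ G.Adj u y := fun hy => hTe x y hx hy hxy
      have := hNq x y hx hxy
      tauto
    by_cases hy : G.Adj u y
    · have := hNq y x hy hxy.symm
      tauto
    have := hq2 x y (mem_farPairs.2 ⟨⟨⟨hxu, hx⟩, hyu, hy⟩, hxy⟩)
    tauto)
  simpa using C.colorable

/-- With nothing at distance two and no far edge, an edge avoiding `u` has both ends in `N(u)` and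
closes a triangle with `u`. -/
theorem adj_mem_triangleNbrs (hS : secondNbrs G u = ∅) (hE : farPairs G u = ∅) {x y : V}
    (hx : x ≠ u) (hy : y ≠ u) (hxy : G.Adj x y) :
    x ∈ triangleNbrs G u ∧ y ∈ triangleNbrs G u := by
  by_cases hux : G.Adj u x
  · by_cases huy : G.Adj u y
    · exact ⟨mem_triangleNbrs.2 ⟨hux, y, huy, hxy.symm⟩, mem_triangleNbrs.2 ⟨huy, x, hux, hxy⟩⟩
    · have : y ∈ secondNbrs G u := mem_secondNbrs.2 ⟨⟨hy, huy⟩, x, hux, hxy⟩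
      simp [hS] at this
  · by_cases huy : G.Adj u y
    · have : x ∈ secondNbrs G u := mem_secondNbrs.2 ⟨⟨hx, hux⟩, y, huy, hxy.symm⟩
      simp [hS] at this
    · have : (x, y) ∈ farPairs G u := mem_farPairs.2 ⟨⟨⟨hx, hux⟩, hy, huy⟩, hxy⟩
      simp [hE] at this

theorem adj_of_mem_support (hS : secondNbrs G u = ∅) (hE : farPairs G u = ∅) {x : V}
    (hx : x ∈ G.support) (hxu : x ≠ u) : G.Adj u x := by
  obtain ⟨y, hxy⟩ := G.mem_support.1 hx
  by_cases hy : y = u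
  · exact hy ▸ hxy.symm
  · exact (mem_triangleNbrs.1 (adj_mem_triangleNbrs hS hE hxu hy hxy).1).1

theorem ncard_support (hS : secondNbrs G u = ∅) (hE : farPairs G u = ∅) (hd : 0 < G.degree u) :
    G.support.ncard = G.degree u + 1 := by
  have : G.support = ((insert u (G.neighborFinset u) : Finset V) : Set V) := by
    ext x
    simp only [coe_insert, Set.mem_insert_iff, mem_coe, mem_neighborFinset]
    constructor
    · intro hx
      by_cases hxu : x = u
      · exact Or.inl hxu
      · exact Or.inr (adj_of_mem_support hS hE hx hxu)
    · rintro (rfl | h)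
      · obtain ⟨w, hw⟩ := (G.degree_pos_iff_exists_adj x).1 hd
        exact G.mem_support.2 ⟨w, hw⟩
      · exact G.mem_support.2 ⟨u, h.symm⟩
  rw [this, Set.ncard_coe_finset, card_insert_of_notMem (by simp), card_neighborFinset_eq_degree]

theorem exists_partner {a : V} (ha : a ∈ triangleNbrs G u) :
    ∃ b ∈ triangleNbrs G u, G.Adj a b := by
  obtain ⟨hua, b, hub, hba⟩ := mem_triangleNbrs.1 ha
  exact ⟨b, mem_triangleNbrs.2 ⟨hub, a, hua, hba.symm⟩, hba.symm⟩

theorem isoUpToIsolated_starPlus_one (hS : secondNbrs G u = ∅) (hE : farPairs G u = ∅)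
    (hT : #(triangleNbrs G u) = 2) {n : ℕ} (hn : G.degree u + 1 = n) :
    IsoUpToIsolated G (starPlus n 1) := by
  obtain ⟨a, b, hab, hTab⟩ := card_eq_two.1 hT
  have ha : a ∈ triangleNbrs G u := by simp [hTab]
  have hb : b ∈ triangleNbrs G u := by simp [hTab]
  have hua := (mem_triangleNbrs.1 ha).1
  have hub := (mem_triangleNbrs.1 hb).1
  have hadj : G.Adj a b := by
    obtain ⟨c, hc, hac⟩ := exists_partner ha
    rw [hTab] at hc
    simp only [mem_insert, mem_singleton] at hc
    rcases hc with rfl | rfl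
    · exact absurd rfl hac.ne
    · exact hac
  have hsupp : ∀ {x}, G.Adj u x → x ∈ G.support := fun h => G.mem_support.2 ⟨u, h.symm⟩
  refine isoUpToIsolated_starPlus G
    (hn ▸ ncard_support hS hE ((G.degree_pos_iff_exists_adj u).2 ⟨a, hua⟩))
    (fun i => if i = 0 then u else if i = 1 then a else b) ?_ ?_ ?_ ?_
  · intro i _
    split_ifs
    exacts [G.mem_support.2 ⟨a, hua⟩, hsupp hua, hsupp hub]
  · intro i hi j hj hij
    have := hua.ne
    have := hub.ne
    simp only [Set.mem_ofPred_eq] at hi hj hij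
    split_ifs at hij <;> first | omega | (subst hij; contradiction)
  · intro x hx hxu
    exact adj_of_mem_support hS hE hx hxu
  · intro x y hx hy
    simp only [if_true] at hx hy
    constructor
    · intro hxy
      obtain ⟨h1, h2⟩ := adj_mem_triangleNbrs hS hE hx hy hxy
      have := hxy.ne
      refine ⟨0, by omega, ?_⟩
      simp only [hTab, mem_insert, mem_singleton] at h1 h2
      grind
    · rintro ⟨t, ht, h⟩
      obtain rfl : t = 0 := by omega
      rcases h with ⟨rfl, rfl⟩ | ⟨rfl, rfl⟩
      · simpa using hadj
      · simpa using hadj.symm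

theorem isoUpToIsolated_starPlus_two
    (hC : ∀ w ≠ u, ∀ v v', G.Adj u v → G.Adj v w → G.Adj u v' → G.Adj v' w → v = v')
    (hS : secondNbrs G u = ∅) (hE : farPairs G u = ∅)
    (hT : #(triangleNbrs G u) = 4) {n : ℕ} (hn : G.degree u + 1 = n) :
    IsoUpToIsolated G (starPlus n 2) := by
  obtain ⟨a, ha⟩ : (triangleNbrs G u).Nonempty := card_pos.1 (by omega)
  obtain ⟨b, hb, hab⟩ := exists_partner ha
  have hcard : #((triangleNbrs G u) \ {a, b}) = 2 := by
    rw [card_sdiff_of_subset (by simp [insert_subset_iff, ha, hb]), hT, card_pair hab.ne]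
  obtain ⟨c, e, hce, hTce⟩ := card_eq_two.1 hcard
  have hmem : ∀ x, x ∈ triangleNbrs G u ↔ x = a ∨ x = b ∨ x = c ∨ x = e := by
    intro x
    have : x ∈ (triangleNbrs G u) \ {a, b} ↔ x ∈ ({c, e} : Finset V) := by rw [hTce]
    simp only [mem_sdiff, mem_insert, mem_singleton] at this
    constructor
    · tauto
    · rintro (rfl | rfl | h | h)
      · exact ha
      · exact hb
      · exact (this.2 (Or.inl h)).1
      · exact (this.2 (Or.inr h)).1
  have hc' : c ∈ (triangleNbrs G u) \ {a, b} := by simp [hTce]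
  have he' : e ∈ (triangleNbrs G u) \ {a, b} := by simp [hTce]
  simp only [mem_sdiff, mem_insert, mem_singleton, not_or] at hc' he'
  obtain ⟨hc, hca, hcb⟩ := hc'
  obtain ⟨he, hea, heb⟩ := he'
  have hua := (mem_triangleNbrs.1 ha).1
  have hub := (mem_triangleNbrs.1 hb).1
  have huc := (mem_triangleNbrs.1 hc).1
  have hue := (mem_triangleNbrs.1 he).1
  -- The edges inside `N(u)` form a matching: two edges at `x` would give `x` and `u` two common
  -- neighbours.
  have huniq : ∀ x y y', G.Adj u x → G.Adj u y → G.Adj u y' → G.Adj x y → G.Adj x y' → y = y' :=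
    fun x y y' hx hy hy' h h' => hC x hx.ne' y y' hy h.symm hy' h'.symm
  have hadj : G.Adj c e := by
    obtain ⟨f, hf, hcf⟩ := exists_partner hc
    rcases (hmem f).1 hf with rfl | rfl | rfl | rfl
    · exact absurd (huniq f b c hua hub huc hab hcf.symm) (Ne.symm hcb)
    · exact absurd (huniq f a c hub hua huc hab.symm hcf.symm) (Ne.symm hca)
    · exact absurd rfl hcf.ne
    · exact hcf
  have hsupp : ∀ {x}, G.Adj u x → x ∈ G.support := fun h => G.mem_support.2 ⟨u, h.symm⟩
  refine isoUpToIsolated_starPlus G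
    (hn ▸ ncard_support hS hE ((G.degree_pos_iff_exists_adj u).2 ⟨a, hua⟩))
    (fun i => if i = 0 then u else if i = 1 then a else if i = 2 then b else
      if i = 3 then c else e) ?_ ?_ ?_ ?_
  · intro i _
    split_ifs
    exacts [G.mem_support.2 ⟨a, hua⟩, hsupp hua, hsupp hub, hsupp huc, hsupp hue]
  · intro i hi j hj hij
    have := hua.ne
    have := hub.ne
    have := huc.ne
    have := hue.ne
    have := hab.ne
    simp only [Set.mem_ofPred_eq] at hi hj hij
    grind
  · intro x hx hxu
    exact adj_of_mem_support hS hE hx hxu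
  · intro x y hx hy
    simp only [if_true] at hx hy
    constructor
    · intro hxy
      obtain ⟨h1, h2⟩ := adj_mem_triangleNbrs hS hE hx hy hxy
      have hux := (mem_triangleNbrs.1 h1).1
      have huy := (mem_triangleNbrs.1 h2).1
      rcases (hmem x).1 h1 with rfl | rfl | rfl | rfl
      · exact ⟨0, by omega, Or.inl ⟨by simp, huniq x y b hux huy hub hxy hab⟩⟩
      · exact ⟨0, by omega, Or.inr ⟨huniq x y a hux huy hua hxy hab.symm, by simp⟩⟩
      · exact ⟨1, by omega, Or.inl ⟨by simp, huniq x y e hux huy hue hxy hadj⟩⟩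
      · exact ⟨1, by omega, Or.inr ⟨huniq x y c hux huy huc hxy hadj.symm, by simp⟩⟩
    · rintro ⟨t, ht, h⟩
      obtain rfl | rfl : t = 0 ∨ t = 1 := by omega
      · rcases h with ⟨rfl, rfl⟩ | ⟨rfl, rfl⟩
        · simpa using hab
        · simpa using hab.symm
      · rcases h with ⟨rfl, rfl⟩ | ⟨rfl, rfl⟩
        · simpa using hadj
        · simpa using hadj.symm

theorem card_triangleNbrs_ne_one : #(triangleNbrs G u) ≠ 1 := by
  intro h
  obtain ⟨a, ha⟩ := card_eq_one.1 h
  obtain ⟨b, hb, hab⟩ := exists_partner (a := a) (u := u) (G := G) (by simp [ha])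
  rw [ha, mem_singleton] at hb
  exact hab.ne hb.symm

/-- Swapping the entries acts on far pairs without fixed points. -/
theorem card_farPairs_ne_one : #(farPairs G u) ≠ 1 := by
  intro h
  obtain ⟨p, hp⟩ := card_eq_one.1 h
  have hp' : p ∈ farPairs G u := by simp [hp]
  have := swap_mem_farPairs hp'
  rw [hp, mem_singleton] at this
  exact (mem_farPairs.1 hp').2.ne (congrArg Prod.snd this)

/-- A graph without `C_4` whose spectral radius is at least the root `r` belonging to `S_{m-1}^2` is
bipartite or one of `S_m^1`, `S_{m-1}^2`. -/
theorem classification {m : ℕ} {r : ℝ} (hr : 7 < r)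
    (hroot : (r ^ 2 - ((m : ℝ) - 2)) * (r - 1) = 4) (hm : G.edgeSet.ncard = m)
    (hG : r ≤ spectralRadius G) (hbip : ¬ G.IsBipartite)
    (hC4 : ¬ (cycleGraph 4).IsContained G) :
    IsoUpToIsolated G (starPlus m 1) ∨ IsoUpToIsolated G (starPlus (m - 1) 2) := by
  have hne : Nonempty V := by
    by_contra h
    rw [not_nonempty_iff] at h
    exact hbip ⟨Coloring.mk (fun v => isEmptyElim v) fun {v} => isEmptyElim v⟩
  obtain ⟨u, z, hu, hz0, hz1, hz⟩ := exists_normalized_subeigenvector G (by linarith)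
  have hC : ∀ w ≠ u, ∀ v v', G.Adj u v → G.Adj v w → G.Adj u v' → G.Adj v' w → v = v' := by
    intro w hw v v' huv hvw huv' hvw'
    by_contra hvv
    exact hC4 (cycleGraph_four_isContained hw.symm hvv huv hvw hvw'.symm huv'.symm)
  have hcount := two_mul_card_edges hC
  rw [hm] at hcount
  have h1 := sq_le_degree_add hC (by linarith) hu hz
  have h2 := mul_sum_triangleNbrs_le hC hu hz0 hz
  have h3 := mul_sum_secondNbrs_le hC hz1 hz
  have hX : 0 ≤ ∑ w ∈ triangleNbrs G u, z w := sum_nonneg fun w _ => hz0 w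
  have hY : 0 ≤ ∑ w ∈ secondNbrs G u, z w := sum_nonneg fun w _ => hz0 w
  have h4 := excess_le_four hr hroot hG hcount h1 h2 h3 hX hY
  have h5 := four_le_of_root_le hr hroot hG
  set ρ := spectralRadius G
  have hρ7 : 7 < ρ := hr.trans_le hG
  have hcR : (2 : ℝ) * m = 2 * G.degree u + #(triangleNbrs G u) + 2 * #(secondNbrs G u) +
      #(farPairs G u) := by exact_mod_cast hcount
  have hT1 := card_triangleNbrs_ne_one (G := G) (u := u)
  have hE1 := card_farPairs_ne_one (G := G) (u := u)
  by_cases hT0 : #(triangleNbrs G u) = 0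
  · exfalso
    refine hbip (isBipartite_of_triangleNbrs_eq_empty (card_eq_zero.1 hT0) ?_ (by omega))
    by_contra! hE
    -- More than two far pairs leave only `ε = 4`, `ν = 0`, so `d = m - 2` and `ρ² ≤ m - 2`, which
    -- is too small.
    have hS0 : #(secondNbrs G u) = 0 := by omega
    have hE4 : (4 : ℝ) ≤ #(farPairs G u) := by
      have : 4 ≤ #(farPairs G u) := by omega
      exact_mod_cast this
    rw [card_eq_zero.1 hT0, card_eq_zero.1 hS0] at h1
    simp only [sum_empty, add_zero] at h1
    rw [hT0, hS0] at hcR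
    push_cast at hcR
    nlinarith
  by_cases hT4 : #(triangleNbrs G u) = 4
  · right
    exact isoUpToIsolated_starPlus_two hC (card_eq_zero.1 (by omega)) (card_eq_zero.1 (by omega))
      hT4 (by omega)
  -- The value `3` would need `ε = 1` by parity, which is impossible.
  have hT2 : #(triangleNbrs G u) = 2 := by omega
  by_cases hrest : #(secondNbrs G u) = 0 ∧ #(farPairs G u) = 0
  · left
    exact isoUpToIsolated_starPlus_one (card_eq_zero.1 hrest.1) (card_eq_zero.1 hrest.2) hT2
      (by omega)
  exfalso
  rw [hT2] at h2 hcR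
  -- What remains is `(ν, ε) = (1, 0)` or `(0, 2)`, each of excess exactly `4`.
  have hd : (m : ℝ) - 2 = G.degree u := by
    have : m = G.degree u + 2 := by omega
    rw [this]
    push_cast
    ring
  rw [hd] at h5
  set X := ∑ w ∈ triangleNbrs G u, z w
  set Y := ∑ w ∈ secondNbrs G u, z w with hYdef
  have h6 : (ρ ^ 2 - G.degree u) * (ρ - 1) ≤ (X + Y) * (ρ - 1) :=
    mul_le_mul_of_nonneg_right (by linarith) (by linarith)
  have h7 : ρ * Y ≤ 1 := by
    by_cases hS0 : #(secondNbrs G u) = 0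
    · rw [hYdef, card_eq_zero.1 hS0]
      simp
    · have hS1 : #(secondNbrs G u) = 1 := by omega
      have hE0 : #(farPairs G u) = 0 := by omega
      simpa [hS1, hE0] using h3
  push_cast at h2
  -- From `(ρ-1)X ≤ 2 + Y` follows `4 ≤ (X + Y)(ρ-1) ≤ 2 + ρY ≤ 3`, a contradiction.
  nlinarith

end Cases

end QuadrilateralSpectral

/-! ### The main theorem -/

open QuadrilateralSpectral SimpleGraph in
theorem theorem1p3 (m : ℕ) (hm : 51 ≤ m) :
    √((m : ℝ) - 2) < spectralRadius (starPlus (m - 1) 2) ∧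
    ∀ (V : Type*) [Fintype V] (G : SimpleGraph V),
      ¬ G.IsBipartite →
      G.edgeSet.ncard = m →
      spectralRadius (starPlus (m - 1) 2) ≤ spectralRadius G →
      (cycleGraph 4).IsContained G ∨
        IsoUpToIsolated G (starPlus m 1) ∨
        IsoUpToIsolated G (starPlus (m - 1) 2) ∨
        IsoUpToIsolated G (cycleStar (m - 5)) := by
  obtain ⟨r, hr, hr7, hroot⟩ := exists_root (m := (m : ℝ)) (by exact_mod_cast hm)
  have hle := root_le_spectralRadius_starPlus hm (by linarith) hroot
  refine ⟨hr.trans_le hle, fun V _ G hbip hedges hρ => ?_⟩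
  by_cases hC4 : (cycleGraph 4).IsContained G
  · exact Or.inl hC4
  · rcases classification hr7 hroot hedges (hle.trans hρ) hbip hC4 with h | h
    · exact Or.inr (Or.inl h)
    · exact Or.inr (Or.inr (Or.inl h))
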